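/- **Setting.** Consider a spinning test body (pole-dipole approximation with the Tulczyjew condition $S^{\alpha\beta}p_\beta=0$) of mass $m=1$ outside the horizon of a Schwarzschild black hole of mass $\mu=1$, with coordinates $(t,r,\theta,\varphi)$ and $a(r)=1-2/r$. The reduced phase space has coordinates $(\vec E,\vec Z,r,P_r)\in\mathbb R^3\times\mathbb R^3\times(2,\infty)\times\mathbb R$ with $Z_2>|E_1|$. For an energy $\mathcal E\in\mathbb R$ put $\Theta=\frac{Z_1}{Z_2}\sqrt{Z_2^2-E_1^2}$, $\Gamma=\sqrt{a(r)(Z_2^2-E_1^2)}-E_2$, $$\mathsf m^2=-a(r)P_r^2+\frac{(\Theta-\mathcal E r^2)^2}{r^3(r-2)}-\frac{E_3^2+\Gamma^2}{r^2},$$ $$V=\mathsf m^2r^3-2Z_1^2-Z_2^2+Z_3^2+3E_1^2\Bigl(1+\frac{Z_1^2}{Z_2^2}\Bigr),$$ $$\begin{aligned}H={}&a(r)\Bigl[\tfrac12+\tfrac{2\Theta^2+Z_2^2-E_1^2}{V}\Bigr]P_r^2+\tfrac{\Gamma+E_2}{rV}\Bigl[E_1E_3\bigl(\tfrac{Z_1^2}{Z_2^2}-1\bigr)-Z_3E_2\tfrac{Z_1}{Z_2}\Bigr]P_r+\tfrac{Z_2^2-E_1^2}{r^3V}\bigl[r\Gamma^2+Z_1^2\bigr]\\&-\tfrac{(\Theta-r^2\mathcal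 E)^2}{r^3(r-2)}\Bigl[\tfrac12-\tfrac{Z_1^2+Z_3^2-3\Theta^2}{V}\Bigr]+\tfrac{\sqrt{Z_2^2-E_1^2}}{rV}\bigl[Z_3(\Theta-2r\mathcal E)P_r-Z_1Z_2\mathcal E\bigr]+\tfrac{E_3^2+\Gamma^2}{r^2}\Bigl[\tfrac12-\tfrac{2E_1^2}{V}\Bigr]\\&-\tfrac{\Theta-r^2\mathcal E}{r^2V\sqrt{r(r-2)}}\bigl[E_1E_3Z_3+Z_1Z_2E_2\bigr]-\tfrac1{r^2V}\Bigl[\tfrac{Z_1}{Z_2}E_1E_3+Z_3\Gamma\Bigr]^2,\end{aligned}$$ where the expression for $\mathsf m^2$ is substituted into $V$. The reduced system is $$\frac{d\vec E}{d\tau}=\vec E\times\frac{\partial H}{\partial\vec E},\quad \frac{d\vec Z}{d\tau}=(\mathbf J\vec Z)\times\frac{\partial H}{\partial\vec Z},\quad \frac{dP_r}{d\tau}=-\frac{\partial H}{\partial r},\quad\frac{dr}{d\tau}=\frac{\partial H}{\partial P_r},\qquad \mathbf J=\mathrm{diag}(1,-1,1).$$ It is regular where $V\ne0$. Its Casimir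 functions are $C_\circ=-Z_1^2+Z_2^2-Z_3^2=c^2$ (with $c>0$ the spin length) and $F=E_1^2+E_2^2+E_3^2=\ell$. The Tulczyjew manifold is given by $$-\Theta P_r-\sqrt{Z_2^2-E_1^2}\,\frac{Z_3}{r}+\frac{E_2Z_2Z_3-E_1Z_1E_3}{Z_2\sqrt{r(r-2)}}=0,\qquad \mathcal E\Theta-\frac{\Theta^2}{r^2}+(\Gamma+E_2)\frac{\Gamma}{r}=0 .$$ The unreduced variables are $(y^\alpha)=(t,r,\theta,\varphi)$ with $0<\theta<\pi$, the conjugate momenta $P_\alpha$, and vectors $\vec L,\vec M$ with $(\vec L,\vec M)=0$ and $n:=\sqrt{L_2^2+L_3^2}>0$. In the orthonormal tetrad proportional to $\partial_t,\partial_r,\partial_\theta,\partial_\varphi$ the spin tensor is $S^{0i}=M_i$, $S^{12}=L_3$, $S^{13}=-L_2$, $S^{23}=L_1$. The momentum of the body is $p_\alpha=P_\alpha+\frac12\omega_{\alpha AB}S^{AB}$, where $\omega_{\alpha AB}=-\omega_{\alpha BA}$ are the Ricci rotation coefficients of the tetrad, with nonzero components $\omega_{t01}=-r^{-2}$, $\omega_{\theta12}=-\sqrt{a}$,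 $\omega_{\varphi13}=-\sqrt a\sin\theta$, $\omega_{\varphi23}=-\cos\theta$ up to antisymmetry. The energy is $\mathcal E=-P_t$. Such a point lies over the reduced point with the same $r,P_r$ and, with $Y=(L_1\cos\theta-P_\varphi)/\sin\theta$, $$\vec E=\Bigl(L_1,\ \frac{L_3P_\theta+L_2Y}{n},\ \frac{-L_2P_\theta+L_3Y}{n}\Bigr),\qquad \vec Z=\Bigl(-\frac{M_1|\vec L|}{n},\ |\vec L|,\ \frac{M_2L_3-M_3L_2}{n}\Bigr).$$ Coordinates are chosen so that the total angular momentum is $\vec Q=(0,0,P_\varphi)$, i.e. $Q_1=Q_2=0$ where $$Q_1=\tfrac{\cos\varphi}{\sin\theta}(L_1-P_\varphi\cos\theta)-P_\theta\sin\varphi,\qquad Q_2=\tfrac{\sin\varphi}{\sin\theta}(L_1-P_\varphi\cos\theta)+P_\theta\cos\varphi .$$ The motion is recovered from $$\frac{d\varphi}{d\tau}=\frac{P_\varphi}{E_2^2+E_3^2}\Bigl(E_2\frac{\partial H}{\partial E_2}+E_3\frac{\partial H}{\partial E_3}\Bigr),\qquad \frac{dt}{d\tau}=-\frac{\partial H}{\partial\mathcal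 E},$$ the velocity is time-like if $$U=\frac1{a}\Bigl(\frac{\partial H}{\partial P_r}\Bigr)^2+r^2\Bigl(\frac{\partial H}{\partial E_2}\Bigr)^2+r^2\Bigl(\frac{\partial H}{\partial E_3}\Bigr)^2-a\Bigl(\frac{\partial H}{\partial\mathcal E}\Bigr)^2<0,$$ and the spin (Pauli–Lubanski) vector is $S^\alpha=\frac{\varepsilon^{\alpha\beta\mu\nu}}{2\sqrt{-g}}p_\beta S_{\mu\nu}$, with $\varepsilon^{\alpha\beta\mu\nu}$ the antisymmetric symbol, $\varepsilon^{0123}=-1$. **Theorem.** Let $z,\mathcal E\in\mathbb R$ satisfy $$z\mathcal E>0,\qquad z^2+27(1-z\mathcal E)>0,\qquad \frac{(1-z\mathcal E)(z-9\mathcal E)^2}{z^2+27(1-z\mathcal E)}-1>0,$$ and let $\mathcal N_1^\pm$ be the points $$\vec E=(0,E_2,E_3^\pm),\quad \vec Z=\bigl(z,\sqrt{z^2+27(1-z\mathcal E)},0\bigr),\quad r=3,\quad P_r=0,$$ $$E_2=\frac{3\sqrt3\,(3-2z\mathcal E)}{\sqrt{z^2+27(1-z\mathcal E)}},\qquad E_3^\pm=\pm3\sqrt{\frac{(1-z\mathcal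 E)(z-9\mathcal E)^2}{z^2+27(1-z\mathcal E)}-1}.$$ 1. $\mathcal N_1^\pm$ lie in the regular region ($Z_2>|E_1|$, $V\neq0$, and $H$ is differentiable there), on the Tulczyjew manifold, and on the level $\mathsf m^2=1$; they are equilibrium points of the reduced system, and $\pm E_3^\pm>0$. Moreover $U=-z\mathcal E<0$. 2. They describe equatorial circular orbits whose spin is not parallel to the orbital angular momentum: $dt/d\tau=3\mathcal E$; there are points of the unreduced phase space with energy $\mathcal E$ and $Q_1=Q_2=0$ lying over $\mathcal N_1^\pm$, and for every such point $r=3$, $\theta=\pi/2$, $P_\theta=0$, $P_\varphi\ne0$, $P_\varphi^2=\ell$, $d\varphi/d\tau=P_\varphi/9$, $S^{\alpha\beta}p_\beta=0$, $p_\alpha p^\alpha=-1$, and $$S^r=0,\qquad S^\theta\ne0,\qquad S^\varphi\neq0 .$$ 3. On $\mathcal N_1^\pm$ one has $c^2>0$, $z=\dfrac{27-c^2}{27\mathcal E}$, and $(\ell,c,\mathcal E)$ lies on the surface $$\Sigma_1=\Bigl\{(\ell,c,\mathcal E)\ :\ \frac{c^2}{3}+27\mathcal E^2-\ell=9,\ \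 0<c<3\sqrt3,\ \ \ell>\ell^*\Bigr\},\qquad \ell^*=\frac29c^2-\frac32+\frac3c\sqrt{27+\frac{13}{4}c^2-\frac{2}{27}c^4}.$$ Conversely, every point of $\Sigma_1$ is attained in this way by some $z$ (satisfying the three inequalities above), on both families. -/

import Mathlib

noncomputable section

namespace SpinningBody

open Matrix

/-! Units: gravitational constant and velocity of light equal to one, mass of the black hole
`μ = 1`, mass of the test body `m = 1`.  Three-vectors are indexed by `Fin 3`
(component `1, 2, 3` is index `0, 1, 2`); space-time indices are `0, 1, 2, 3 = t, r, θ, φ`, and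
tetrad indices are `0, 1, 2, 3`. -/

/-- A point of the reduced phase space. -/
structure RState where
  E : Fin 3 → ℝ
  Z : Fin 3 → ℝ
  r : ℝ
  Pr : ℝ

/-- The lapse factor `a(r) = 1 - 2 / r` of the Schwarzschild metric. -/
def lapse (r : ℝ) : ℝ := 1 - 2 / r

namespace RState

/-- The Casimir function `C∘ = -Z₁² + Z₂² - Z₃²` (square of the spin length). -/
def casimirC (s : RState) : ℝ := -(s.Z 0) ^ 2 + (s.Z 1) ^ 2 - (s.Z 2) ^ 2

/-- The Casimir function `F = E₁² + E₂² + E₃²` (square of the total angular momentum). -/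
def casimirF (s : RState) : ℝ := (s.E 0) ^ 2 + (s.E 1) ^ 2 + (s.E 2) ^ 2

/-- `√(Z₂² - E₁²)`. -/
def rho (s : RState) : ℝ := √((s.Z 1) ^ 2 - (s.E 0) ^ 2)

/-- `Θ = (Z₁ / Z₂) √(Z₂² - E₁²)`. -/
def Theta (s : RState) : ℝ := s.Z 0 / s.Z 1 * s.rho

/-- `Γ = √(a(r) (Z₂² - E₁²)) - E₂`. -/
def Gam (s : RState) : ℝ := √(lapse s.r * ((s.Z 1) ^ 2 - (s.E 0) ^ 2)) - s.E 1

/-- The square of the mass of the test body, `m² = -p_α p^α`, as a function on the reduced phase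
space; `en` is the energy. -/
def massSq (en : ℝ) (s : RState) : ℝ :=
  -lapse s.r * s.Pr ^ 2 + (s.Theta - en * s.r ^ 2) ^ 2 / (s.r ^ 3 * (s.r - 2))
    - ((s.E 2) ^ 2 + s.Gam ^ 2) / s.r ^ 2

/-- The function `V`, with the expression for `m²` substituted. -/
def V (en : ℝ) (s : RState) : ℝ :=
  massSq en s * s.r ^ 3 - 2 * (s.Z 0) ^ 2 - (s.Z 1) ^ 2 + (s.Z 2) ^ 2
    + 3 * (s.E 0) ^ 2 * (1 + (s.Z 0) ^ 2 / (s.Z 1) ^ 2)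

/-- The reduced Hamiltonian. -/
def H (en : ℝ) (s : RState) : ℝ :=
  lapse s.r * (1 / 2 + (2 * s.Theta ^ 2 + (s.Z 1) ^ 2 - (s.E 0) ^ 2) / V en s) * s.Pr ^ 2
  + (s.Gam + s.E 1) / (s.r * V en s)
      * (s.E 0 * s.E 2 * ((s.Z 0) ^ 2 / (s.Z 1) ^ 2 - 1) - s.Z 2 * s.E 1 * (s.Z 0 / s.Z 1)) * s.Pr
  + ((s.Z 1) ^ 2 - (s.E 0) ^ 2) / (s.r ^ 3 * V en s) * (s.r * s.Gam ^ 2 + (s.Z 0) ^ 2)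
  - (s.Theta - s.r ^ 2 * en) ^ 2 / (s.r ^ 3 * (s.r - 2))
      * (1 / 2 - ((s.Z 0) ^ 2 + (s.Z 2) ^ 2 - 3 * s.Theta ^ 2) / V en s)
  + s.rho / (s.r * V en s)
      * (s.Z 2 * (s.Theta - 2 * s.r * en) * s.Pr - s.Z 0 * s.Z 1 * en)
  + ((s.E 2) ^ 2 + s.Gam ^ 2) / s.r ^ 2 * (1 / 2 - 2 * (s.E 0) ^ 2 / V en s)
  - (s.Theta - s.r ^ 2 * en) / (s.r ^ 2 * V en s * √(s.r * (s.r - 2)))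
      * (s.E 0 * s.E 2 * s.Z 2 + s.Z 0 * s.Z 1 * s.E 1)
  - 1 / (s.r ^ 2 * V en s) * (s.Z 0 / s.Z 1 * s.E 0 * s.E 2 + s.Z 2 * s.Gam) ^ 2

/-- `∂H/∂E`. -/
def dHdE (en : ℝ) (s : RState) : Fin 3 → ℝ := fun i =>
  deriv (fun x : ℝ => H en { s with E := Function.update s.E i x }) (s.E i)

/-- `∂H/∂Z`. -/
def dHdZ (en : ℝ) (s : RState) : Fin 3 → ℝ := fun i =>
  deriv (fun x : ℝ => H en { s with Z := Function.update s.Z i x }) (s.Z i)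

/-- `∂H/∂r`. -/
def dHdr (en : ℝ) (s : RState) : ℝ := deriv (fun x : ℝ => H en { s with r := x }) s.r

/-- `∂H/∂P_r`. -/
def dHdPr (en : ℝ) (s : RState) : ℝ := deriv (fun x : ℝ => H en { s with Pr := x }) s.Pr

/-- The derivative of `H` with respect to the energy. -/
def dHden (en : ℝ) (s : RState) : ℝ := deriv (fun x : ℝ => H x s) en

/-- The vector field of the reduced system:
`dE/dτ = E × ∂H/∂E`, `dZ/dτ = (J Z) × ∂H/∂Z` with `J = diag(1, -1, 1)`,
`dr/dτ = ∂H/∂P_r`, `dP_r/dτ = -∂H/∂r`. -/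
def vectorField (en : ℝ) (s : RState) : RState where
  E := s.E ⨯₃ dHdE en s
  Z := ![s.Z 0, -s.Z 1, s.Z 2] ⨯₃ dHdZ en s
  r := dHdPr en s
  Pr := -dHdr en s

/-- The Hamiltonian is differentiable, jointly in all its variables and the energy. -/
def HDifferentiableAt (en : ℝ) (s : RState) : Prop :=
  DifferentiableAt ℝ
    (fun w : ℝ × (Fin 3 → ℝ) × (Fin 3 → ℝ) × ℝ × ℝ =>
      H w.1 ⟨w.2.1, w.2.2.1, w.2.2.2.1, w.2.2.2.2⟩)
    (en, s.E, s.Z, s.r, s.Pr)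

/-- An equilibrium point of the reduced system. -/
def IsEquilibrium (en : ℝ) (s : RState) : Prop :=
  HDifferentiableAt en s ∧ vectorField en s = ⟨0, 0, 0, 0⟩

/-- The part of the reduced phase space on which the reduced system is free of singularities:
outside the horizon, with `Z₂ > |E₁|` and `V ≠ 0`. -/
def IsRegular (en : ℝ) (s : RState) : Prop :=
  2 < s.r ∧ |s.E 0| < s.Z 1 ∧ V en s ≠ 0

/-- The Tulczyjew manifold: the two independent relations `S^{αβ} p_β = 0` with `α = t, r`,
in reduced variables (up to nonzero factors). -/
def OnTulczyjew (en : ℝ) (s : RState) : Prop :=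
  -s.Theta * s.Pr - s.rho * s.Z 2 / s.r
      + (s.E 1 * s.Z 1 * s.Z 2 - s.E 0 * s.Z 0 * s.E 2) / (s.Z 1 * √(s.r * (s.r - 2))) = 0
  ∧ en * s.Theta - s.Theta ^ 2 / s.r ^ 2 + (s.Gam + s.E 1) * s.Gam / s.r = 0

/-- `dt/dτ = -∂H/∂𝓔`. -/
def tRate (en : ℝ) (s : RState) : ℝ := -dHden en s

/-- `dφ/dτ = P_φ / (E₂² + E₃²) * (E₂ ∂H/∂E₂ + E₃ ∂H/∂E₃)`. -/
def phiRate (en Pphi : ℝ) (s : RState) : ℝ :=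
  Pphi / ((s.E 1) ^ 2 + (s.E 2) ^ 2) * (s.E 1 * dHdE en s 1 + s.E 2 * dHdE en s 2)

/-- The square `u_α u^α` of the velocity (for `m = 1`), in reduced variables. -/
def velSq (en : ℝ) (s : RState) : ℝ :=
  1 / lapse s.r * (dHdPr en s) ^ 2 + s.r ^ 2 * (dHdE en s 1) ^ 2 + s.r ^ 2 * (dHdE en s 2) ^ 2
    - lapse s.r * (dHden en s) ^ 2

end RState

/-- A point of the unreduced phase space: position `y`, momentum `P_α` canonically conjugate to
it, and the vectors `L`, `M` which make up the spin tensor in the orthonormal tetrad. -/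
structure FState where
  y : Fin 4 → ℝ
  P : Fin 4 → ℝ
  L : Fin 3 → ℝ
  M : Fin 3 → ℝ

namespace FState

/-- The Schwarzschild metric `g_{αα}` (it is diagonal). -/
def metric (x : FState) : Fin 4 → ℝ :=
  ![-lapse (x.y 1), 1 / lapse (x.y 1), (x.y 1) ^ 2, (x.y 1) ^ 2 * Real.sin (x.y 2) ^ 2]

/-- The orthonormal tetrad `e_A^α` obtained by normalizing the coordinate basis (it is diagonal). -/
def tetrad (x : FState) : Fin 4 → ℝ :=
  ![1 / √(lapse (x.y 1)), √(lapse (x.y 1)), 1 / x.y 1, 1 / (x.y 1 * Real.sin (x.y 2))]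

/-- The spin tensor `S^{AB}` in the tetrad. -/
def spinTetrad (x : FState) : Matrix (Fin 4) (Fin 4) ℝ :=
  !![0, x.M 0, x.M 1, x.M 2;
     -x.M 0, 0, x.L 2, -x.L 1;
     -x.M 1, -x.L 2, 0, x.L 0;
     -x.M 2, x.L 1, -x.L 0, 0]

/-- The Ricci rotation coefficients `ω_{α A B} = g(e_A, ∇_α e_B)`. -/
def ricciRotation (x : FState) : Fin 4 → Matrix (Fin 4) (Fin 4) ℝ :=
  ![!![0, -1 / (x.y 1) ^ 2, 0, 0; 1 / (x.y 1) ^ 2, 0, 0, 0; 0, 0, 0, 0; 0, 0, 0, 0],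
    0,
    !![0, 0, 0, 0; 0, 0, -√(lapse (x.y 1)), 0; 0, √(lapse (x.y 1)), 0, 0; 0, 0, 0, 0],
    !![0, 0, 0, 0;
       0, 0, 0, -√(lapse (x.y 1)) * Real.sin (x.y 2);
       0, 0, 0, -Real.cos (x.y 2);
       0, √(lapse (x.y 1)) * Real.sin (x.y 2), Real.cos (x.y 2), 0]]

/-- The linear momentum `p_α = P_α + (1/2) ω_{αAB} S^{AB}` of the body. -/
def momentum (x : FState) (α : Fin 4) : ℝ :=
  x.P α + 1 / 2 * ∑ A, ∑ B, x.ricciRotation α A B * x.spinTetrad A B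

/-- `p_α p^α`. -/
def momentumSq (x : FState) : ℝ := ∑ α, (x.momentum α) ^ 2 / x.metric α

/-- The spin tensor `S^{αβ}` in the coordinate basis. -/
def spin (x : FState) (α β : Fin 4) : ℝ := x.spinTetrad α β * x.tetrad α * x.tetrad β

/-- The spin tensor `S_{αβ}` with lowered indices. -/
def spinLow (x : FState) (α β : Fin 4) : ℝ := x.metric α * x.metric β * x.spin α β

/-- The antisymmetric symbol `[αβμν]` with `[0123] = 1`. -/
def leviCivita (α β μ ν : Fin 4) : ℝ :=
  (Matrix.of fun i j : Fin 4 => if ![α, β, μ, ν] i = j then (1 : ℝ) else 0).det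

/-- The Pauli-Lubanski (spin) vector `S^α = ε^{αβμν} p_β S_{μν} / (2 m √(-g))` with `m = 1` and
`√(-g) = r² sin θ`; since `ε_{0123} = 1`, raising the indices gives `ε^{αβμν} = -[αβμν]`. -/
def pauliLubanski (x : FState) (α : Fin 4) : ℝ :=
  1 / (2 * ((x.y 1) ^ 2 * Real.sin (x.y 2)))
    * ∑ β, ∑ μ, ∑ ν, -leviCivita α β μ ν * x.momentum β * x.spinLow μ ν

/-- The integral `Q₁`. -/
def Q1 (x : FState) : ℝ :=
  Real.cos (x.y 3) / Real.sin (x.y 2) * (x.L 0 - x.P 3 * Real.cos (x.y 2))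
    - x.P 2 * Real.sin (x.y 3)

/-- The integral `Q₂`. -/
def Q2 (x : FState) : ℝ :=
  Real.sin (x.y 3) / Real.sin (x.y 2) * (x.L 0 - x.P 3 * Real.cos (x.y 2))
    + x.P 2 * Real.cos (x.y 3)

/-- The reduced variables of a point of the unreduced phase space. -/
def reduce (x : FState) : RState where
  E := ![x.L 0,
    x.L 2 * x.P 2 / √((x.L 1) ^ 2 + (x.L 2) ^ 2)
      + x.L 1 * ((x.L 0 * Real.cos (x.y 2) - x.P 3)
          / (Real.sin (x.y 2) * √((x.L 1) ^ 2 + (x.L 2) ^ 2))),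
    -(x.L 1 * x.P 2 / √((x.L 1) ^ 2 + (x.L 2) ^ 2))
      + x.L 2 * ((x.L 0 * Real.cos (x.y 2) - x.P 3)
          / (Real.sin (x.y 2) * √((x.L 1) ^ 2 + (x.L 2) ^ 2)))]
  Z := ![-(x.M 0 * √(x.L ⬝ᵥ x.L) / √((x.L 1) ^ 2 + (x.L 2) ^ 2)),
    √(x.L ⬝ᵥ x.L),
    (x.M 1 * x.L 2 - x.M 2 * x.L 1) / √((x.L 1) ^ 2 + (x.L 2) ^ 2)]
  r := x.y 1
  Pr := x.P 1

/-- `x` is a point of the unreduced phase space with energy `𝓔 = -P_t` and `(L, M) = 0` that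
reduces to `s`, in coordinates in which the total angular momentum vector is `Q = (0, 0, P_φ)`. -/
def IsLift (en : ℝ) (s : RState) (x : FState) : Prop :=
  0 < x.y 2 ∧ x.y 2 < Real.pi ∧ 0 < (x.L 1) ^ 2 + (x.L 2) ^ 2 ∧ -x.P 0 = en ∧
    x.L ⬝ᵥ x.M = 0 ∧ x.Q1 = 0 ∧ x.Q2 = 0 ∧ x.reduce = s

end FState

/-- The domain of the parameter `z` at energy `en`: the inequality `z 𝓔 > 0`, and positivity of
the expressions under the square roots in the families of equilibria. -/
def InDomain (en z : ℝ) : Prop :=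
  0 < z * en ∧ 0 < z ^ 2 + 27 * (1 - z * en) ∧
    0 < (1 - z * en) * (z - 9 * en) ^ 2 / (z ^ 2 + 27 * (1 - z * en)) - 1

/-- The points of the families `𝒩₁^±`, with `sgn = 1` for `𝒩₁^+` and `sgn = -1` for `𝒩₁^-`. -/
def N1 (sgn en z : ℝ) : RState where
  E := ![0, 3 * √3 * (3 - 2 * z * en) / √(z ^ 2 + 27 * (1 - z * en)),
    sgn * (3 * √((1 - z * en) * (z - 9 * en) ^ 2 / (z ^ 2 + 27 * (1 - z * en)) - 1))]
  Z := ![z, √(z ^ 2 + 27 * (1 - z * en)), 0]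
  r := 3
  Pr := 0

/-- The value `ℓ*` as a function of `c`. -/
def ellStar (c : ℝ) : ℝ :=
  2 / 9 * c ^ 2 - 3 / 2 + 3 / c * √(27 + 13 / 4 * c ^ 2 - 2 / 27 * c ^ 4)

/-- The surface `Σ₁` in the space of the triples `(ℓ, c, 𝓔)`. -/
def Sigma1 : Set (ℝ × ℝ × ℝ) :=
  {q | 0 < q.2.1 ∧ q.2.1 ^ 2 < 27 ∧ q.2.1 ^ 2 / 3 + 27 * q.2.2 ^ 2 - q.1 = 9 ∧
    ellStar q.2.1 < q.1}

end SpinningBody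

end

/-! On the slice `E₁ = Z₃ = P_r = 0` the Hamiltonian collapses to `-m²/2 + N/V` with `N = sliceNum`
(`H_slice`). In each of the three suppressed variables, the other two being zero, `H` is even, so
the derivatives transverse to the slice vanish. At a point of the families `m² = 1`, `N = 0` and `V
= -3z(z - 9𝓔) ≠ 0`, and along the slice `dH = -3𝓔 d𝓔 + (E₂ dE₂ + E₃ dE₃)/9 + (Z₁ dZ₁ - Z₂ dZ₂)/27`,
without a `dr` term (`IsFamilyPoint.hasDerivAt_H`). Hence `∂H/∂E = E/9` and `∂H/∂Z = JZ/27` are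
parallel to the gradients of the Casimir functions, and both cross products vanish. The same formula
yields `dt/dτ`, `dφ/dτ` and, with `ℓ = 27𝓔² - 9z𝓔`, the value of `U`.

Upstairs, `Q₁ = Q₂ = 0` and `E₁ = 0` force the equatorial plane, because `E₃ ≠ 0` excludes `P_φ =
0`; the spin tensor and the momentum are then explicit (`isLift_imp`, `lift_spec`).

For the surface, `c² = 27(1 - z𝓔)` determines `z`, and `ℓ > ℓ*` turns out to be the reality
condition for `E₃` (`ellStar_lt_iff`). -/

namespace SpinningBody
open Matrix

/-! ### Restriction of the Hamiltonian to the slice `E₁ = Z₃ = P_r = 0`. -/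

/-- The function `m²` on the slice `E₁ = Z₃ = P_r = 0`, with `s` in place of `√(r (r - 2))`. -/
noncomputable def sliceMassSq (en e₂ e₃ z w r s : ℝ) : ℝ :=
  (z - en * r ^ 2) ^ 2 / (r ^ 3 * (r - 2)) - (e₃ ^ 2 + (s * w / r - e₂) ^ 2) / r ^ 2

/-- The numerator of the part of `H` with denominator `V` on the slice `E₁ = Z₃ = P_r = 0`. -/
noncomputable def sliceNum (en e₂ z w r s : ℝ) : ℝ :=
  w ^ 2 * (r * (s * w / r - e₂) ^ 2 + z ^ 2) / r ^ 3
    - 2 * z ^ 2 * ((z - en * r ^ 2) ^ 2 / (r ^ 3 * (r - 2)))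
    - z * w ^ 2 * en / r - (z - en * r ^ 2) * (z * w * e₂) / (r ^ 2 * s)

/-- The function `V` on the slice `E₁ = Z₃ = P_r = 0`. -/
noncomputable def sliceV (en e₂ e₃ z w r s : ℝ) : ℝ :=
  sliceMassSq en e₂ e₃ z w r s * r ^ 3 - 2 * z ^ 2 - w ^ 2

lemma sqrt_lapse_mul_sq {w r : ℝ} (hw : 0 < w) (hr : 2 < r) :
    √(lapse r * w ^ 2) = √(r * (r - 2)) * w / r := by
  have h0 : 0 < r := by linarith
  have : lapse r * w ^ 2 = r * (r - 2) * (w / r) ^ 2 := by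
    unfold lapse; field_simp
  rw [this, Real.sqrt_mul (by nlinarith), Real.sqrt_sq (by positivity)]
  ring

section slice
variable {en e₂ e₃ z w r : ℝ} (hw : 0 < w) (hr : 2 < r)
include hw

lemma rho_slice : RState.rho ⟨![0, e₂, e₃], ![z, w, 0], r, 0⟩ = w := by
  simp [RState.rho, Real.sqrt_sq hw.le]

lemma Theta_slice : RState.Theta ⟨![0, e₂, e₃], ![z, w, 0], r, 0⟩ = z := by
  rw [RState.Theta, rho_slice hw]
  simp [hw.ne']

include hr

lemma Gam_slice :
    RState.Gam ⟨![0, e₂, e₃], ![z, w, 0], r, 0⟩ = √(r * (r - 2)) * w / r - e₂ := by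
  simp [RState.Gam, sqrt_lapse_mul_sq hw hr]

lemma massSq_slice : RState.massSq en ⟨![0, e₂, e₃], ![z, w, 0], r, 0⟩ =
    sliceMassSq en e₂ e₃ z w r √(r * (r - 2)) := by
  rw [RState.massSq, Gam_slice hw hr, Theta_slice hw]
  simp [sliceMassSq]

lemma V_slice : RState.V en ⟨![0, e₂, e₃], ![z, w, 0], r, 0⟩ =
    sliceV en e₂ e₃ z w r √(r * (r - 2)) := by
  rw [RState.V, massSq_slice hw hr]
  simp [sliceV]

lemma H_slice : RState.H en ⟨![0, e₂, e₃], ![z, w, 0], r, 0⟩ =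
    -sliceMassSq en e₂ e₃ z w r √(r * (r - 2)) / 2
      + sliceNum en e₂ z w r √(r * (r - 2)) / sliceV en e₂ e₃ z w r √(r * (r - 2)) := by
  rw [RState.H, V_slice hw hr, Gam_slice hw hr, Theta_slice hw, rho_slice hw]
  generalize sliceV en e₂ e₃ z w r √(r * (r - 2)) = V
  simp only [sliceMassSq, sliceNum, cons_val_zero, cons_val_one, cons_val, mul_inv, div_eq_mul_inv]
  ring

end slice

/-! ### Algebra of the two families and the differential of `H` on them. -/

/-- The relations which characterize the two families of equilibria. -/
structure IsFamilyPoint (en z w e₂ e₃ : ℝ) : Prop where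
  pos : 0 < z * en
  w_pos : 0 < w
  w_sq : w ^ 2 = z ^ 2 + 27 * (1 - z * en)
  w_mul : w * e₂ = 3 * √3 * (3 - 2 * z * en)
  sq : e₃ ^ 2 = 9 * ((1 - z * en) * (z - 9 * en) ^ 2 / w ^ 2 - 1)
  ne : e₃ ≠ 0

namespace IsFamilyPoint
variable {en z w e₂ e₃ : ℝ} (h : IsFamilyPoint en z w e₂ e₃)
include h

/-- Otherwise `e₃² = -9`. With `z_ne` this is what keeps `V` away from zero. -/
lemma sub_ne : z - 9 * en ≠ 0 := by
  intro h0
  have := h.sq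
  rw [h0] at this
  norm_num at this
  nlinarith [sq_nonneg e₃]

lemma z_ne : z ≠ 0 := fun h0 => by simpa [h0] using h.pos

/-- Eliminates radicals: with `u = √3 / w` the quantities `e₂` and `Γ` become `u` times polynomials
in `z` and `𝓔`, and only `u² w² = 3` is needed afterwards. -/
lemma exists_inv : ∃ u : ℝ, √3 = u * w ∧ u ^ 2 * w ^ 2 = 3 ∧ e₂ = u * (9 - 6 * z * en) ∧
    √3 * w / 3 - e₂ = u * z * (z - 9 * en) / 3 := by
  have hw := h.w_pos.ne'
  have e : e₂ = √3 / w * (9 - 6 * z * en) := by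
    have := h.w_mul
    field_simp
    linear_combination this
  refine ⟨√3 / w, by field_simp, by field_simp; simp, e, ?_⟩
  rw [e]
  field_simp
  linear_combination h.w_sq

lemma sliceMassSq_eq : sliceMassSq en e₂ e₃ z w 3 √3 = 1 := by
  obtain ⟨u, h1, h2, h3, h4⟩ := h.exists_inv
  have hw := h.w_pos.ne'
  have hs := h.sq
  rw [sliceMassSq, h4, hs]
  have : u ^ 2 = 3 / w ^ 2 := by field_simp; linarith
  have e : (u * z * (z - 9 * en) / 3) ^ 2 = z ^ 2 * (z - 9 * en) ^ 2 / (3 * w ^ 2) := by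
    have : (u * z * (z - 9 * en) / 3) ^ 2 = u ^ 2 * z ^ 2 * (z - 9 * en) ^ 2 / 9 := by ring
    rw [this, ‹u ^ 2 = _›]; field_simp; ring
  rw [e]
  field_simp
  have := h.w_sq
  linear_combination (z - 9 * en) ^ 2 * this

lemma sliceV_eq : sliceV en e₂ e₃ z w 3 √3 = -3 * z * (z - 9 * en) := by
  rw [sliceV, h.sliceMassSq_eq, h.w_sq]; ring

lemma sliceNum_eq : sliceNum en e₂ z w 3 √3 = 0 := by
  obtain ⟨u, h1, h2, h3, h4⟩ := h.exists_inv
  have hu : u ≠ 0 := fun h0 => by simp [h0] at h2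
  have hw := h.w_pos.ne'
  have e : z * w * e₂ / √3 = z * (9 - 6 * z * en) := by
    rw [h1, h3]; field_simp
  rw [sliceNum, h4]
  have e' : (z - en * 3 ^ 2) * (z * w * e₂) / (3 ^ 2 * √3)
      = (z - en * 3 ^ 2) * (z * w * e₂ / √3) / 9 := by
    field_simp; ring
  rw [e', e]
  linear_combination (z ^ 2 * (z - 9 * en) ^ 2 / 81) * h2 + (z * (z - 9 * en) / 27) * h.w_sq

/-- The differential of the Hamiltonian at a point of the families, along a curve in the slice
`E₁ = Z₃ = P_r = 0`. -/
lemma hasDerivAt_H {fen fe₂ fe₃ fz fw fr : ℝ → ℝ} {en' e₂' e₃' z' w' r' t : ℝ}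
    (hen : HasDerivAt fen en' t) (he₂ : HasDerivAt fe₂ e₂' t) (he₃ : HasDerivAt fe₃ e₃' t)
    (hz : HasDerivAt fz z' t) (hw : HasDerivAt fw w' t) (hr : HasDerivAt fr r' t)
    (hen0 : fen t = en) (he₂0 : fe₂ t = e₂) (he₃0 : fe₃ t = e₃) (hz0 : fz t = z)
    (hw0 : fw t = w) (hr0 : fr t = 3) :
    HasDerivAt (fun x => RState.H (fen x) ⟨![0, fe₂ x, fe₃ x], ![fz x, fw x, 0], fr x, 0⟩)
      (-3 * en * en' + (e₂ * e₂' + e₃ * e₃') / 9 + (z * z' - w * w') / 27) t := by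
  -- The slice formula needs `Z₂ > 0` and `r > 2`, which hold only near `t`.
  have hev : ∀ᶠ x in nhds t, 0 < fw x ∧ 2 < fr x :=
    (hw.continuousAt.eventually_const_lt (by rw [hw0]; exact h.w_pos)).and
      (hr.continuousAt.eventually_const_lt (by rw [hr0]; norm_num))
  refine HasDerivAt.congr_of_eventuallyEq ?_ (hev.mono fun x hx => H_slice hx.1 hx.2)
  have hs3 : √(3 * (3 - 2)) = √3 := by norm_num
  have hs : HasDerivAt (fun x => √(fr x * (fr x - 2))) (2 * r' / √3) t := by
    refine ((hr.fun_mul (hr.sub_const 2)).sqrt (by norm_num [hr0])).congr_deriv ?_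
    rw [hr0, hs3]; ring
  set s : ℝ → ℝ := fun x => √(fr x * (fr x - 2)) with hsdef
  have hs0 : s t = √3 := by rw [← hs3]; simp [hsdef, hr0]
  change HasDerivAt (fun x => -sliceMassSq (fen x) (fe₂ x) (fe₃ x) (fz x) (fw x) (fr x) (s x) / 2
    + sliceNum (fen x) (fe₂ x) (fz x) (fw x) (fr x) (s x)
      / sliceV (fen x) (fe₂ x) (fe₃ x) (fz x) (fw x) (fr x) (s x)) _ t
  -- From here on `√(r (r - 2))` is an independent function, known only through its value and
  -- derivative at `t`.
  clear_value s
  obtain ⟨u, h1, h2, h3, h4⟩ := h.exists_inv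
  have hu : u ≠ 0 := fun h0 => by simp [h0] at h2
  have hwn := h.w_pos.ne'
  have hzn := h.z_ne
  have hTn := h.sub_ne
  have hG : HasDerivAt (fun x => s x * fw x / fr x - fe₂ x)
      (2 * r' * w / (3 * √3) + √3 * w' / 3 - √3 * w * r' / 9 - e₂') t := by
    refine (((hs.mul hw).div hr (by rw [hr0]; norm_num)).sub he₂).congr_deriv ?_
    simp only [Pi.mul_apply, hr0, hs0, hw0]
    field_simp
    ring
  have hG0 : s t * fw t / fr t - fe₂ t = u * z * (z - 9 * en) / 3 := by
    rw [hs0, hw0, hr0, he₂0, h4]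
  have hT : HasDerivAt (fun x => fz x - fen x * fr x ^ 2) (z' - 9 * en' - 6 * en * r') t := by
    refine (hz.sub (hen.mul (hr.pow 2))).congr_deriv ?_
    simp [hr0, hen0]; ring
  have hK : HasDerivAt (fun x => (fz x - fen x * fr x ^ 2) ^ 2 / (fr x ^ 3 * (fr x - 2)))
      (2 * (z - 9 * en) * (z' - 9 * en' - 6 * en * r') / 27
        - 2 * (z - 9 * en) ^ 2 * r' / 27) t := by
    refine ((hT.pow 2).div ((hr.pow 3).mul (hr.sub_const 2)) (by simp [hr0]; norm_num)).congr_deriv ?_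
    simp [hr0, hen0, hz0]; ring
  have hm : HasDerivAt (fun x => sliceMassSq (fen x) (fe₂ x) (fe₃ x) (fz x) (fw x) (fr x) (s x))
      (2 * (z - 9 * en) * (z' - 9 * en' - 6 * en * r') / 27 - 2 * (z - 9 * en) ^ 2 * r' / 27
        - (2 * e₃ * e₃' + 2 * (u * z * (z - 9 * en) / 3)
          * (2 * r' * w / (3 * √3) + √3 * w' / 3 - √3 * w * r' / 9 - e₂')) / 9
        + 2 * (e₃ ^ 2 + (u * z * (z - 9 * en) / 3) ^ 2) * r' / 27) t := by
    refine (hK.sub (((he₃.fun_pow 2).add (hG.fun_pow 2)).div (hr.fun_pow 2)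
      (by norm_num [hr0]))).congr_deriv ?_
    simp only [Pi.add_apply, hG0]
    simp only [hr0, he₃0]
    ring
  have hN : HasDerivAt (fun x => sliceNum (fen x) (fe₂ x) (fz x) (fw x) (fr x) (s x))
      ((2 * w * w' * (3 * (u * z * (z - 9 * en) / 3) ^ 2 + z ^ 2)
          + w ^ 2 * (r' * (u * z * (z - 9 * en) / 3) ^ 2 + 6 * (u * z * (z - 9 * en) / 3)
            * (2 * r' * w / (3 * √3) + √3 * w' / 3 - √3 * w * r' / 9 - e₂') + 2 * z * z')) / 27
        - w ^ 2 * (3 * (u * z * (z - 9 * en) / 3) ^ 2 + z ^ 2) * r' / 27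
        - (4 * z * z' * ((z - 9 * en) ^ 2 / 27)
          + 2 * z ^ 2 * (2 * (z - 9 * en) * (z' - 9 * en' - 6 * en * r') / 27
            - 2 * (z - 9 * en) ^ 2 * r' / 27))
        - ((z' * w ^ 2 * en + 2 * z * w * w' * en + z * w ^ 2 * en') / 3 - z * w ^ 2 * en * r' / 9)
        - (((z' - 9 * en' - 6 * en * r') * (z * w * e₂)
            + (z - 9 * en) * (z' * w * e₂ + z * w' * e₂ + z * w * e₂')) / (9 * √3)
          - (z - 9 * en) * z * w * e₂ * (12 * r') / (81 * √3))) t := by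
    have h1 := ((hw.fun_pow 2).fun_mul ((hr.fun_mul (hG.fun_pow 2)).fun_add (hz.fun_pow 2))).fun_div
      (hr.fun_pow 3) (by norm_num [hr0])
    have h2 := ((hz.fun_pow 2).const_mul 2).fun_mul hK
    have h3 := ((hz.fun_mul (hw.fun_pow 2)).fun_mul hen).fun_div hr (by norm_num [hr0])
    have h4 := (hT.fun_mul ((hz.fun_mul hw).fun_mul he₂)).fun_div ((hr.fun_pow 2).fun_mul hs)
      (by norm_num [hr0, hs0])
    refine (((h1.fun_sub h2).fun_sub h3).fun_sub h4).congr_deriv ?_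
    simp only [hG0]
    simp only [hr0, hs0, hen0, he₂0, hz0, hw0]
    have h5 : (√3 : ℝ) ^ 2 = 3 := by norm_num
    generalize √(3 : ℝ) = q at h5
    have h6 : q ≠ 0 := fun h0 => by norm_num [h0] at h5
    congr 1
    · push_cast; ring
    · field_simp
      rw [h5]
      ring
  have hm0 := h.sliceMassSq_eq
  have hV := h.sliceV_eq
  have hN0 := h.sliceNum_eq
  have hVd := ((hm.fun_mul (hr.fun_pow 3)).fun_sub ((hz.fun_pow 2).const_mul 2)).fun_sub (hw.fun_pow 2)
  have hV0 : sliceV (fen t) (fe₂ t) (fe₃ t) (fz t) (fw t) (fr t) (s t) = -3 * z * (z - 9 * en) := by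
    rw [hen0, he₂0, he₃0, hz0, hw0, hr0, hs0, hV]
  have hH := (hm.fun_neg.div_const 2).fun_add (hN.fun_div (d := fun x => sliceV _ _ _ _ _ _ _)
    hVd (by rw [hV0]; simp [hzn, hTn]))
  refine hH.congr_deriv ?_
  have hq : 1 / √3 = u * w / 3 := by
    rw [div_eq_div_iff (by positivity) (by norm_num), ← h1]
    norm_num
  -- The condition `m² = 1` solved for `e₃²`, which gives a form free of `w`.
  have hE : e₃ ^ 2 = 9 * ((z - 9 * en) ^ 2 / 27 - 1) - (u * z * (z - 9 * en) / 3) ^ 2 := by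
    have := hm0
    rw [sliceMassSq, h4] at this
    norm_num at this
    linear_combination (-9) * this
  simp only [hV0]
  -- Since `N = 0` here, the derivative of `N/V` is `N'/V`, and that of `V` drops out.
  rw [hen0, he₂0, hz0, hw0, hr0, hs0, hN0, zero_mul, sub_zero]
  have hVn : -3 * z * (z - 9 * en) ≠ 0 := by simp [hzn, hTn]
  rw [pow_two (-3 * z * (z - 9 * en)), mul_div_mul_right _ _ hVn, div_add_div _ _ (by norm_num) hVn,
    div_eq_iff (mul_ne_zero (by norm_num) hVn)]
  rw [one_div] at hq
  simp only [div_eq_mul_inv, mul_inv, hq]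
  rw [h1, h3]
  have hw2 := h.w_sq
  clear * - h2 hw2 hE
  grind

end IsFamilyPoint
-- Regularity, transverse derivatives and the equilibrium property.
lemma deriv_eq_zero_of_even {f : ℝ → ℝ} (hf : ∀ x, f (-x) = f x) : deriv f 0 = 0 := by
  have h := deriv_comp_neg f 0
  simp only [hf, neg_zero] at h
  linarith

lemma differentiableAt_H {en : ℝ} {s : RState} (h : s.IsRegular en) :
    s.HDifferentiableAt en := by
  obtain ⟨hr, hZ, hV⟩ := h
  have hZ1 : s.Z 1 ≠ 0 := ((abs_nonneg _).trans_lt hZ).ne'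
  have hρ : (s.Z 1) ^ 2 - (s.E 0) ^ 2 ≠ 0 := by
    have := sq_lt_sq' (neg_lt_of_abs_lt hZ) (lt_of_abs_lt hZ)
    linarith
  have hr0 : s.r ≠ 0 := by linarith
  have hr2 : s.r - 2 ≠ 0 := by linarith
  have ha : lapse s.r ≠ 0 := by
    rw [lapse, one_sub_div hr0]; exact div_ne_zero hr2 hr0
  have dl : DifferentiableAt ℝ (fun w : ℝ × (Fin 3 → ℝ) × (Fin 3 → ℝ) × ℝ × ℝ =>
      lapse w.2.2.2.1) (en, s.E, s.Z, s.r, s.Pr) := by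
    unfold lapse
    fun_prop (disch := simpa)
  have dρ : DifferentiableAt ℝ (fun w : ℝ × (Fin 3 → ℝ) × (Fin 3 → ℝ) × ℝ × ℝ =>
      RState.rho ⟨w.2.1, w.2.2.1, w.2.2.2.1, w.2.2.2.2⟩) (en, s.E, s.Z, s.r, s.Pr) := by
    unfold RState.rho
    fun_prop (disch := simpa)
  have dΘ : DifferentiableAt ℝ (fun w : ℝ × (Fin 3 → ℝ) × (Fin 3 → ℝ) × ℝ × ℝ =>
      RState.Theta ⟨w.2.1, w.2.2.1, w.2.2.2.1, w.2.2.2.2⟩) (en, s.E, s.Z, s.r, s.Pr) := by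
    unfold RState.Theta
    fun_prop (disch := simpa)
  have dΓ : DifferentiableAt ℝ (fun w : ℝ × (Fin 3 → ℝ) × (Fin 3 → ℝ) × ℝ × ℝ =>
      RState.Gam ⟨w.2.1, w.2.2.1, w.2.2.2.1, w.2.2.2.2⟩) (en, s.E, s.Z, s.r, s.Pr) := by
    unfold RState.Gam
    fun_prop (disch := simp [ha, hρ])
  have dm : DifferentiableAt ℝ (fun w : ℝ × (Fin 3 → ℝ) × (Fin 3 → ℝ) × ℝ × ℝ =>
      RState.massSq w.1 ⟨w.2.1, w.2.2.1, w.2.2.2.1, w.2.2.2.2⟩) (en, s.E, s.Z, s.r, s.Pr) := by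
    unfold RState.massSq
    fun_prop (disch := simp [hr0, hr2])
  have dV : DifferentiableAt ℝ (fun w : ℝ × (Fin 3 → ℝ) × (Fin 3 → ℝ) × ℝ × ℝ =>
      RState.V w.1 ⟨w.2.1, w.2.2.1, w.2.2.2.1, w.2.2.2.2⟩) (en, s.E, s.Z, s.r, s.Pr) := by
    unfold RState.V
    fun_prop (disch := simp [hZ1])
  have hV' : RState.V en ⟨s.E, s.Z, s.r, s.Pr⟩ ≠ 0 := hV
  have hsq : √(s.r * (s.r - 2)) ≠ 0 := by
    have : 0 < s.r * (s.r - 2) := mul_pos (by linarith) (by linarith)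
    positivity
  unfold RState.HDifferentiableAt RState.H
  fun_prop (disch := simp [hZ1, hr0, hr2, hV', hsq])

/-- With `Z₃ = P_r = 0`, `E₁` enters `H` only through its square. The next two lemmas use the same
parity in `Z₃` and in `P_r`. -/
lemma dHdE_zero_eq_zero {en e₂ e₃ z w r : ℝ} :
    RState.dHdE en ⟨![0, e₂, e₃], ![z, w, 0], r, 0⟩ 0 = 0 := by
  refine deriv_eq_zero_of_even fun x => ?_
  simp [RState.H, RState.V, RState.massSq, RState.Gam, RState.Theta, RState.rho]

lemma dHdZ_two_eq_zero {en e₂ e₃ z w r : ℝ} :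
    RState.dHdZ en ⟨![0, e₂, e₃], ![z, w, 0], r, 0⟩ 2 = 0 := by
  refine deriv_eq_zero_of_even fun x => ?_
  simp [RState.H, RState.V, RState.massSq, RState.Gam, RState.Theta, RState.rho]

lemma dHdPr_eq_zero {en e₂ e₃ z w r : ℝ} :
    RState.dHdPr en ⟨![0, e₂, e₃], ![z, w, 0], r, 0⟩ = 0 := by
  refine deriv_eq_zero_of_even fun x => ?_
  simp [RState.H, RState.V, RState.massSq, RState.Gam, RState.Theta, RState.rho]

namespace IsFamilyPoint
variable {en z w e₂ e₃ : ℝ} (h : IsFamilyPoint en z w e₂ e₃)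
include h

lemma dHdE_one : RState.dHdE en ⟨![0, e₂, e₃], ![z, w, 0], 3, 0⟩ 1 = e₂ / 9 := by
  have := (h.hasDerivAt_H (hasDerivAt_const e₂ en) (hasDerivAt_id e₂) (hasDerivAt_const e₂ e₃)
    (hasDerivAt_const e₂ z) (hasDerivAt_const e₂ w) (hasDerivAt_const e₂ 3)
    rfl rfl rfl rfl rfl rfl).deriv
  refine this.trans ?_
  ring

lemma dHdE_two : RState.dHdE en ⟨![0, e₂, e₃], ![z, w, 0], 3, 0⟩ 2 = e₃ / 9 := by
  have := (h.hasDerivAt_H (hasDerivAt_const e₃ en) (hasDerivAt_const e₃ e₂) (hasDerivAt_id e₃)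
    (hasDerivAt_const e₃ z) (hasDerivAt_const e₃ w) (hasDerivAt_const e₃ 3)
    rfl rfl rfl rfl rfl rfl).deriv
  refine this.trans ?_
  ring

lemma dHdZ_zero : RState.dHdZ en ⟨![0, e₂, e₃], ![z, w, 0], 3, 0⟩ 0 = z / 27 := by
  have := (h.hasDerivAt_H (hasDerivAt_const z en) (hasDerivAt_const z e₂) (hasDerivAt_const z e₃)
    (hasDerivAt_id z) (hasDerivAt_const z w) (hasDerivAt_const z 3)
    rfl rfl rfl rfl rfl rfl).deriv
  refine this.trans ?_
  ring

lemma dHdZ_one : RState.dHdZ en ⟨![0, e₂, e₃], ![z, w, 0], 3, 0⟩ 1 = -w / 27 := by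
  have := (h.hasDerivAt_H (hasDerivAt_const w en) (hasDerivAt_const w e₂) (hasDerivAt_const w e₃)
    (hasDerivAt_const w z) (hasDerivAt_id w) (hasDerivAt_const w 3)
    rfl rfl rfl rfl rfl rfl).deriv
  refine this.trans ?_
  ring

lemma dHdr_eq : RState.dHdr en ⟨![0, e₂, e₃], ![z, w, 0], 3, 0⟩ = 0 := by
  have := (h.hasDerivAt_H (hasDerivAt_const 3 en) (hasDerivAt_const 3 e₂) (hasDerivAt_const 3 e₃)
    (hasDerivAt_const 3 z) (hasDerivAt_const 3 w) (hasDerivAt_id 3)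
    rfl rfl rfl rfl rfl rfl).deriv
  refine this.trans ?_
  ring

lemma dHden_eq : RState.dHden en ⟨![0, e₂, e₃], ![z, w, 0], 3, 0⟩ = -3 * en := by
  have := (h.hasDerivAt_H (hasDerivAt_id en) (hasDerivAt_const en e₂) (hasDerivAt_const en e₃)
    (hasDerivAt_const en z) (hasDerivAt_const en w) (hasDerivAt_const en 3)
    rfl rfl rfl rfl rfl rfl).deriv
  refine this.trans ?_
  ring

lemma massSq_eq : RState.massSq en ⟨![0, e₂, e₃], ![z, w, 0], 3, 0⟩ = 1 := by
  rw [massSq_slice h.w_pos (by norm_num), show (3 : ℝ) * (3 - 2) = 3 by norm_num,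
    h.sliceMassSq_eq]

lemma isRegular : RState.IsRegular en ⟨![0, e₂, e₃], ![z, w, 0], 3, 0⟩ := by
  refine ⟨by norm_num, by simpa using h.w_pos, ?_⟩
  rw [V_slice h.w_pos (by norm_num), show (3 : ℝ) * (3 - 2) = 3 by norm_num, h.sliceV_eq]
  simp [h.z_ne, h.sub_ne]

lemma onTulczyjew : RState.OnTulczyjew en ⟨![0, e₂, e₃], ![z, w, 0], 3, 0⟩ := by
  refine ⟨by simp, ?_⟩
  rw [Theta_slice h.w_pos, Gam_slice h.w_pos (by norm_num),
    show (3 : ℝ) * (3 - 2) = 3 by norm_num]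
  obtain ⟨u, h1, h2, h3, h4⟩ := h.exists_inv
  simp only [h4, cons_val_one, cons_val_zero]
  rw [h3]
  linear_combination (u ^ 2 * (z * (z - 9 * en)) / 27) * (-h.w_sq) + (z * (z - 9 * en)) / 27 * h2

lemma isEquilibrium : RState.IsEquilibrium en ⟨![0, e₂, e₃], ![z, w, 0], 3, 0⟩ := by
  refine ⟨differentiableAt_H h.isRegular, ?_⟩
  rw [RState.vectorField, dHdPr_eq_zero, h.dHdr_eq, neg_zero]
  congr 1
  · ext i
    fin_cases i <;>
      simp [cross_apply, h.dHdE_one, h.dHdE_two, dHdE_zero_eq_zero]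
    ring
  · ext i
    fin_cases i <;>
      simp [cross_apply, h.dHdZ_one, h.dHdZ_zero, dHdZ_two_eq_zero]
    ring

lemma ell_eq : e₂ ^ 2 + e₃ ^ 2 = 27 * en ^ 2 - 9 * z * en := by
  obtain ⟨u, h1, h2, h3, h4⟩ := h.exists_inv
  have hw := h.w_pos.ne'
  have hu : u ^ 2 = 3 / w ^ 2 := by field_simp; linarith
  rw [h3, h.sq, mul_pow, hu]
  field_simp
  linear_combination (-9 - 27 * en ^ 2 + 9 * z * en) * h.w_sq

lemma ell_pos : 0 < e₂ ^ 2 + e₃ ^ 2 := by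
  have := sq_nonneg e₂
  have := sq_pos_of_ne_zero h.ne
  linarith

lemma velSq_eq : RState.velSq en ⟨![0, e₂, e₃], ![z, w, 0], 3, 0⟩ = -(z * en) := by
  rw [RState.velSq, dHdPr_eq_zero, h.dHdE_one, h.dHdE_two, h.dHden_eq, lapse]
  linear_combination (1 / 9) * h.ell_eq

lemma phiRate_eq (p : ℝ) :
    RState.phiRate en p ⟨![0, e₂, e₃], ![z, w, 0], 3, 0⟩ = p / 9 := by
  have := h.ell_pos
  simp only [RState.phiRate, h.dHdE_one, h.dHdE_two, cons_val_one, cons_val_zero, cons_val]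
  field_simp

lemma tRate_eq : RState.tRate en ⟨![0, e₂, e₃], ![z, w, 0], 3, 0⟩ = 3 * en := by
  rw [RState.tRate, h.dHden_eq]; ring

end IsFamilyPoint

/-- Both families are treated at once: the relations involve the sign only through `e₃²` and `e₃ ≠
0`. -/
lemma InDomain.isFamilyPoint {en z sgn : ℝ} (h : InDomain en z) (hs : sgn = 1 ∨ sgn = -1) :
    IsFamilyPoint en z √(z ^ 2 + 27 * (1 - z * en))
      (3 * √3 * (3 - 2 * z * en) / √(z ^ 2 + 27 * (1 - z * en)))
      (sgn * (3 * √((1 - z * en) * (z - 9 * en) ^ 2 / (z ^ 2 + 27 * (1 - z * en)) - 1))) := by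
  obtain ⟨h1, h2, h3⟩ := h
  have hw := Real.sqrt_pos.2 h2
  refine ⟨h1, hw, Real.sq_sqrt h2.le, by field_simp, ?_, ?_⟩
  · have : sgn ^ 2 = 1 := by rcases hs with rfl | rfl <;> norm_num
    rw [mul_pow, mul_pow, this, Real.sq_sqrt h3.le, Real.sq_sqrt h2.le]
    ring
  · have := Real.sqrt_pos.2 h3
    rcases hs with rfl | rfl
    · positivity
    · linarith
-- Points of the unreduced phase space over the families, and their spin.
lemma cos_sin_solve {φ a b : ℝ} (h1 : Real.cos φ * a - b * Real.sin φ = 0)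
    (h2 : Real.sin φ * a + b * Real.cos φ = 0) : a = 0 ∧ b = 0 := by
  have h := Real.sin_sq_add_cos_sq φ
  constructor
  · linear_combination Real.cos φ * h1 + Real.sin φ * h2 - a * h
  · linear_combination -Real.sin φ * h1 + Real.cos φ * h2 - b * h

namespace IsFamilyPoint
variable {en z w e₂ e₃ : ℝ} (h : IsFamilyPoint en z w e₂ e₃)
include h

lemma isLift_imp {x : FState} (hx : x.IsLift en ⟨![0, e₂, e₃], ![z, w, 0], 3, 0⟩) :
    x.y 1 = 3 ∧ x.y 2 = Real.pi / 2 ∧ x.P 0 = -en ∧ x.P 1 = 0 ∧ x.P 2 = 0 ∧ x.P 3 ≠ 0 ∧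
      x.L 0 = 0 ∧ x.L 1 * x.P 3 = -(w * e₂) ∧ x.L 2 * x.P 3 = -(w * e₃) ∧
      x.L 1 ^ 2 + x.L 2 ^ 2 = w ^ 2 ∧ x.M 0 = -z ∧ x.M 1 = 0 ∧ x.M 2 = 0 := by
  obtain ⟨hθ0, hθπ, hn, hP0, hLM, hQ1, hQ2, hred⟩ := hx
  rw [FState.reduce, RState.mk.injEq] at hred
  obtain ⟨hE, hZ, hr, hPr⟩ := hred
  have hsin := Real.sin_pos_of_pos_of_lt_pi hθ0 hθπ
  have hE0 := congrFun hE 0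
  have hE1 := congrFun hE 1
  have hE2 := congrFun hE 2
  have hZ0 := congrFun hZ 0
  have hZ1 := congrFun hZ 1
  have hZ2 := congrFun hZ 2
  simp only [cons_val_zero, cons_val_one, cons_val] at hE0 hE1 hE2 hZ0 hZ1 hZ2
  have hw := h.w_pos
  have hLL : x.L ⬝ᵥ x.L = x.L 1 ^ 2 + x.L 2 ^ 2 := by
    rw [dotProduct, Fin.sum_univ_three, hE0]; ring
  rw [hLL] at hZ1 hZ0
  rw [hZ1] at hE1 hE2 hZ0 hZ2
  have hL : x.L 1 ^ 2 + x.L 2 ^ 2 = w ^ 2 := by rw [← hZ1, Real.sq_sqrt hn.le]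
  -- `(Q₁, Q₂)` is a rotation by `φ` of `((L₁ - P_φ cos θ)/sin θ, P_θ)`, so both entries vanish.
  obtain ⟨hA, hP2⟩ := cos_sin_solve (φ := x.y 3)
    (a := (x.L 0 - x.P 3 * Real.cos (x.y 2)) / Real.sin (x.y 2)) (b := x.P 2)
    (by rw [← hQ1, FState.Q1]; ring) (by rw [← hQ2, FState.Q2]; ring)
  rw [div_eq_zero_iff, or_iff_left hsin.ne', hE0, zero_sub, neg_eq_zero] at hA
  rw [hP2, hE0] at hE1 hE2
  have hP3 : x.P 3 ≠ 0 := by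
    intro h0
    rw [h0] at hE2
    apply h.ne
    rw [← hE2]; simp
  have hcos : Real.cos (x.y 2) = 0 := (mul_eq_zero.1 hA).resolve_left hP3
  have hθ : x.y 2 = Real.pi / 2 :=
    Real.injOn_cos ⟨hθ0.le, hθπ.le⟩ ⟨by positivity, by linarith [Real.pi_pos]⟩ (by simp [hcos])
  rw [hθ] at hE1 hE2
  simp only [Real.sin_pi_div_two, Real.cos_pi_div_two] at hE1 hE2
  rw [dotProduct, Fin.sum_univ_three, hE0] at hLM
  rw [div_eq_zero_iff, or_iff_left hw.ne'] at hZ2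
  refine ⟨hr, hθ, by linarith, hPr, hP2, hP3, hE0, ?_, ?_, hL, ?_, ?_, ?_⟩
  · rw [← hE1]; field_simp; ring
  · rw [← hE2]; field_simp; ring
  · rw [← hZ0]; field_simp
  -- As `L₁ = 0`, the conditions `(L, M) = 0` and `Z₃ = 0` make `(M₂, M₃)` orthogonal to `(L₂, L₃)`
  -- and to its quarter turn.
  · have : w ^ 2 * x.M 1 = 0 := by
      rw [← hL]; linear_combination x.L 1 * hLM + x.L 2 * hZ2
    simpa [hw.ne'] using this
  · have : w ^ 2 * x.M 2 = 0 := by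
      rw [← hL]; linear_combination x.L 2 * hLM - x.L 1 * hZ2
    simpa [hw.ne'] using this

lemma exists_lift : ∃ x : FState, x.IsLift en ⟨![0, e₂, e₃], ![z, w, 0], 3, 0⟩ := by
  have hℓ := h.ell_pos
  have hw := h.w_pos
  set p := √(e₂ ^ 2 + e₃ ^ 2) with hp
  have hp0 : 0 < p := Real.sqrt_pos.2 hℓ
  have hpp : p ^ 2 = e₂ ^ 2 + e₃ ^ 2 := Real.sq_sqrt hℓ.le
  have hLL : (w * e₂ / p) ^ 2 + (w * e₃ / p) ^ 2 = w ^ 2 := by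
    field_simp; linear_combination -hpp
  -- The choice `P_φ = √ℓ` fixes `L` through `L₂ P_φ = -w e₂` and `L₃ P_φ = -w e₃`.
  refine ⟨⟨![0, 3, Real.pi / 2, 0], ![-en, 0, 0, p], ![0, -(w * e₂ / p), -(w * e₃ / p)],
    ![-z, 0, 0]⟩, ?_⟩
  refine ⟨by simp [Real.pi_pos], by simp [Real.pi_pos], ?_, by simp, ?_, ?_, ?_, ?_⟩
  · simp only [cons_val_one, cons_val_zero, cons_val, neg_sq, hLL]; positivity
  · simp [dotProduct, Fin.sum_univ_three]
  · simp [FState.Q1]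
  · simp [FState.Q2]
  · have hdot : (![0, -(w * e₂ / p), -(w * e₃ / p)] : Fin 3 → ℝ) ⬝ᵥ
        ![0, -(w * e₂ / p), -(w * e₃ / p)] = w ^ 2 := by
      rw [← hLL]; simp [dotProduct, Fin.sum_univ_three]; ring
    simp only [FState.reduce, hdot, cons_val_one, cons_val_zero, cons_val, neg_sq, hLL,
      Real.sqrt_sq hw.le, Real.sin_pi_div_two, Real.cos_pi_div_two]
    congr 1
    · ext i
      fin_cases i <;> simp <;> field_simp
    · ext i
      fin_cases i <;> simp
      field_simp

/-- The properties of the orbit and of the spin over a point of the families. -/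
lemma lift_spec {x : FState} (hx : x.IsLift en ⟨![0, e₂, e₃], ![z, w, 0], 3, 0⟩) :
    x.y 1 = 3 ∧ x.y 2 = Real.pi / 2 ∧ x.P 2 = 0 ∧ x.P 3 ≠ 0 ∧ x.P 3 ^ 2 = e₂ ^ 2 + e₃ ^ 2 ∧
      (∀ α, ∑ β, x.spin α β * x.momentum β = 0) ∧ x.momentumSq = -1 ∧
      x.pauliLubanski 1 = 0 ∧ x.pauliLubanski 2 ≠ 0 ∧ x.pauliLubanski 3 ≠ 0 := by
  obtain ⟨hr, hθ, hP0, hP1, hP2, hP3, hL0, hL1, hL2, hL, hM0, hM1, hM2⟩ := h.isLift_imp hx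
  have hw := h.w_pos.ne'
  have hℓ : x.P 3 ^ 2 = e₂ ^ 2 + e₃ ^ 2 := by
    have : w ^ 2 * x.P 3 ^ 2 = w ^ 2 * (e₂ ^ 2 + e₃ ^ 2) := by
      rw [← hL]
      linear_combination (x.L 1 * x.P 3 - w * e₂) * hL1 + (x.L 2 * x.P 3 - w * e₃) * hL2
        + (e₂ ^ 2 + e₃ ^ 2) * (-hL)
    exact mul_left_cancel₀ (pow_ne_zero 2 hw) this
  have ha : lapse (x.y 1) = 1 / 3 := by rw [hr, lapse]; norm_num
  have hsa : √(1 / 3 : ℝ) = √3 / 3 := by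
    rw [Real.sqrt_div' _ (by norm_num)]
    have : (√3 : ℝ) ^ 2 = 3 := by norm_num
    field_simp; rw [Real.sqrt_one, one_mul, this]
  have h3 : (√3 : ℝ) ^ 2 = 3 := by norm_num
  have hp0 : x.momentum 0 = (z - 9 * en) / 9 := by
    simp [FState.momentum, FState.ricciRotation, FState.spinTetrad, Fin.sum_univ_four, hr, hP0, hM0]
    ring
  have hp1 : x.momentum 1 = 0 := by
    simp [FState.momentum, FState.ricciRotation, hP1]
  have hp2 : x.momentum 2 = -(√3 / 3 * x.L 2) := by
    simp only [FState.momentum, FState.ricciRotation, ha, hsa]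
    simp [FState.spinTetrad, Fin.sum_univ_four, hP2]
    ring
  have hp3 : x.momentum 3 = x.P 3 + √3 / 3 * x.L 1 := by
    simp only [FState.momentum, FState.ricciRotation, ha, hsa]
    simp [FState.spinTetrad, Fin.sum_univ_four, hL0, hθ]
    ring
  have hg : x.metric = ![-(1 / 3), 3, 9, 9] := by
    simp only [FState.metric, ha]
    simp only [hr, hθ, Real.sin_pi_div_two]; norm_num
  have he : x.tetrad = ![√3, √3 / 3, 1 / 3, 1 / 3] := by
    simp only [FState.tetrad, ha, hsa]
    simp only [hr, hθ, Real.sin_pi_div_two]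
    ext i; fin_cases i <;> simp
  have hS : x.spinTetrad = !![0, -z, 0, 0; z, 0, x.L 2, -x.L 1; 0, -x.L 2, 0, 0;
      0, x.L 1, 0, 0] := by
    simp [FState.spinTetrad, hM0, hM1, hM2, hL0]
  have hLP : √3 * (x.L 1 * x.P 3) = -(9 * (3 - 2 * z * en)) := by
    rw [hL1, h.w_mul]; linear_combination (-3 * (3 - 2 * z * en)) * h3
  have hsl : x.spinLow = fun α β => x.metric α * x.metric β *
      (x.spinTetrad α β * x.tetrad α * x.tetrad β) := rfl
  -- The factor `P_φ` turns `L₂` into `L₂ P_φ`, which is known in terms of `z` and `𝓔`.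
  have hθS : x.pauliLubanski 2 * x.P 3 = en * (z ^ 2 - 9 * z * en + 9) := by
    simp [FState.pauliLubanski, FState.leviCivita, Matrix.det_succ_row_zero, Fin.sum_univ_succ,
      Fin.succAbove, hsl, hg, he, hS, hr, hθ, hp0, hp3]
    linear_combination (-(z / 9)) * hℓ - z / 9 * h.ell_eq - en / 3 * hLP
      - (z / 27) * (x.P 3 ^ 2 + √3 / 3 * x.L 1 * x.P 3) * h3
  have hφS : x.pauliLubanski 3 = -(√3 / 3 * en * x.L 2) := by
    simp [FState.pauliLubanski, FState.leviCivita, Matrix.det_succ_row_zero, Fin.sum_univ_succ,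
      Fin.succAbove, hsl, hg, he, hS, hr, hθ, hp0, hp2]
    linear_combination (-(z / 27) * √3 / 3 * x.L 2) * h3
  have hen : en ≠ 0 := fun h0 => by simpa [h0] using h.pos
  refine ⟨hr, hθ, hP2, hP3, hℓ, ?_, ?_, ?_, ?_, ?_⟩
  · intro α
    fin_cases α <;>
      simp [FState.spin, Fin.sum_univ_four, hS, he, hp0, hp1, hp2, hp3]
    -- Only `α = r` remains: every nonzero entry of the spin tensor has an index `r`, and `p_r = 0`.
    linear_combination (z * (z - 9 * en) / 27 - x.L 1 ^ 2 / 27 - x.L 2 ^ 2 / 27) * h3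
      - (1 / 9) * hL - (1 / 9) * hLP - (1 / 9) * h.w_sq
  · simp [FState.momentumSq, Fin.sum_univ_four, hp0, hp1, hp2, hp3, hg]
    linear_combination ((x.L 1 ^ 2 + x.L 2 ^ 2) / 81) * h3 + (1 / 27) * hL + (1 / 9) * hℓ
      + (1 / 9) * h.ell_eq + (2 / 27) * hLP + (1 / 27) * h.w_sq
  · simp [FState.pauliLubanski, FState.leviCivita, Matrix.det_succ_row_zero, Fin.sum_univ_succ,
      Fin.succAbove, hsl, hg, he, hS]
  -- `S^θ = 0` would give `z² - 9z𝓔 + 9 = 0`, hence `1 - z𝓔 = -z²/9`, and then `e₃² w² < 0`.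
  · intro h0
    rw [h0, zero_mul] at hθS
    have h9 := (mul_eq_zero.1 hθS.symm).resolve_left hen
    have hw2 := pow_pos h.w_pos 2
    have hs : e₃ ^ 2 * w ^ 2 = 9 * ((1 - z * en) * (z - 9 * en) ^ 2 - w ^ 2) := by
      rw [h.sq]; field_simp
    have hneg : (1 - z * en) * (z - 9 * en) ^ 2 = -(z * (z - 9 * en) / 3) ^ 2 := by
      linear_combination ((z - 9 * en) ^ 2 / 9) * h9
    rw [hneg] at hs
    nlinarith [mul_nonneg (sq_nonneg e₃) hw2.le, sq_nonneg (z * (z - 9 * en) / 3)]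
  · rw [hφS]
    have : x.L 2 ≠ 0 := by
      intro h0
      rw [h0, zero_mul, eq_comm, neg_eq_zero] at hL2
      exact (mul_ne_zero hw h.ne) hL2
    simp [hen, this]

end IsFamilyPoint
-- Values of the integrals and the surface `Σ₁`.
lemma casimirF_slice {e₂ e₃ z w r : ℝ} :
    RState.casimirF ⟨![0, e₂, e₃], ![z, w, 0], r, 0⟩ = e₂ ^ 2 + e₃ ^ 2 := by
  simp [RState.casimirF]

lemma IsFamilyPoint.casimirC_eq {en z w e₂ e₃ : ℝ} (h : IsFamilyPoint en z w e₂ e₃) {r : ℝ} :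
    RState.casimirC ⟨![0, e₂, e₃], ![z, w, 0], r, 0⟩ = 27 * (1 - z * en) := by
  simp [RState.casimirC, h.w_sq]

/-- In terms of the spin length, the condition on `ℓ` which defines the surface is the condition
for the square root in the third component of `E` to be real and nonzero. -/
lemma ellStar_lt_iff {ell c en z : ℝ} (hc : 0 < c) (hc' : c ^ 2 < 27) (hen : en ≠ 0)
    (hz : z * en = (27 - c ^ 2) / 27) (hℓ : c ^ 2 / 3 + 27 * en ^ 2 - ell = 9) :
    ellStar c < ell ↔ 0 < (1 - z * en) * (z - 9 * en) ^ 2 - (z ^ 2 + 27 * (1 - z * en)) := by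
  set R := 27 + 13 / 4 * c ^ 2 - 2 / 27 * c ^ 4 with hR
  set x := ell - (2 / 9 * c ^ 2 - 3 / 2) with hx
  set y := 3 / c * √R with hy
  have hR0 : 0 < R := by nlinarith [pow_pos hc 2]
  have hy0 : 0 < y := by positivity
  have hy2 : c ^ 2 * y ^ 2 = 9 * R := by
    rw [hy, mul_pow, Real.sq_sqrt hR0.le]; field_simp; norm_num
  have hen2 : 0 < en ^ 2 := by positivity
  have hc2 : 0 < c ^ 2 := by positivity
  have hell : ell = c ^ 2 / 3 + 27 * en ^ 2 - 9 := by linarith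
  -- Multiplying by `𝓔²` leaves only `z𝓔` and `𝓔²`, functions of `c` and `ℓ` on the surface. The
  -- result is quadratic in `ℓ`, and `ℓ*` is its larger root.
  have key : 243 * en ^ 2 * ((1 - z * en) * (z - 9 * en) ^ 2 - (z ^ 2 + 27 * (1 - z * en)))
      = c ^ 2 * ((x - y) * (x + y)) := by
    have e1 : en ^ 2 * ((1 - z * en) * (z - 9 * en) ^ 2 - (z ^ 2 + 27 * (1 - z * en)))
      = (1 - z * en) * (z * en - 9 * en ^ 2) ^ 2 - ((z * en) ^ 2
        + 27 * (1 - z * en) * en ^ 2) := by ring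
    rw [mul_assoc, e1, hz]
    have : c ^ 2 * ((x - y) * (x + y)) = c ^ 2 * x ^ 2 - 9 * R := by rw [← hy2]; ring
    rw [this, hx, hR, hell]
    ring
  -- This puts `ℓ` above the smaller root. The bound on `y` holds because `c² (y² - (15/2 - c²/9)²)
  -- = (27 - c²)³/81`.
  have hlow : 0 < x + y := by
    have hb : (15 / 2 - c ^ 2 / 9) ^ 2 ≤ y ^ 2 := by
      refine le_of_mul_le_mul_left ?_ hc2
      rw [hy2, hR]
      nlinarith [mul_nonneg (sub_nonneg.2 hc'.le) (sq_nonneg (c ^ 2 / 9 - 3))]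
    have hb' := abs_le_of_sq_le_sq' hb hy0.le
    have : x = c ^ 2 / 9 + 27 * en ^ 2 - 15 / 2 := by rw [hx, hell]; ring
    linarith [hb'.2]
  have : ellStar c < ell ↔ 0 < x - y := by
    rw [ellStar, sub_pos]
    constructor <;> intro _ <;> linarith
  rw [this]
  constructor
  · intro h
    have h1 := mul_pos hc2 (mul_pos h hlow)
    rw [← key] at h1
    exact (mul_pos_iff_of_pos_left (by positivity)).1 h1
  · intro h
    have h1 := mul_pos (mul_pos (show (0 : ℝ) < 243 by norm_num) hen2) h
    rw [key] at h1
    exact (mul_pos_iff_of_pos_right hlow).1 ((mul_pos_iff_of_pos_left hc2).1 h1)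

/-- The third inequality of the domain makes `(1 - z𝓔)(z - 9𝓔)²` exceed a positive number, so `1 -
z𝓔 > 0`, that is, `c² > 0`. -/
lemma InDomain.pos {en z : ℝ} (h : InDomain en z) :
    0 < 1 - z * en ∧ 0 < (1 - z * en) * (z - 9 * en) ^ 2 - (z ^ 2 + 27 * (1 - z * en)) := by
  obtain ⟨-, h2, h3⟩ := h
  rw [sub_pos, one_lt_div h2] at h3
  exact ⟨pos_of_mul_pos_left (h2.trans h3) (sq_nonneg _), sub_pos.2 h3⟩

lemma InDomain.mem_Sigma1 {en z : ℝ} (h : InDomain en z) :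
    (27 * en ^ 2 - 9 * z * en, √(27 * (1 - z * en)), en) ∈ Sigma1 := by
  obtain ⟨h1, h2⟩ := h.pos
  have hen : en ≠ 0 := fun h0 => by simpa [h0] using h.1
  have hc : 0 < √(27 * (1 - z * en)) := Real.sqrt_pos.2 (by linarith)
  have hc2 : √(27 * (1 - z * en)) ^ 2 = 27 * (1 - z * en) := Real.sq_sqrt (by linarith)
  have hc27 : √(27 * (1 - z * en)) ^ 2 < 27 := by rw [hc2]; linarith [h.1]
  have hsurf : √(27 * (1 - z * en)) ^ 2 / 3 + 27 * en ^ 2 - (27 * en ^ 2 - 9 * z * en) = 9 := by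
    rw [hc2]; ring
  exact ⟨hc, hc27, hsurf, (ellStar_lt_iff hc hc27 hen (by rw [hc2]; ring) hsurf).2 h2⟩

lemma exists_inDomain {ell c en : ℝ} (h : (ell, c, en) ∈ Sigma1) :
    ∃ z, InDomain en z ∧ 27 * (1 - z * en) = c ^ 2 ∧ 27 * en ^ 2 - 9 * z * en = ell := by
  obtain ⟨hc, hc27, hsurf, hlt⟩ := h
  simp only at hc hc27 hsurf hlt
  -- At `𝓔 = 0` the surface has `ℓ = c²/3 - 9`, and `ℓ > ℓ* ≥ 2c²/9 - 3/2` would require `c² >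
  -- 135/2`.
  have hen : en ≠ 0 := by
    intro h0
    have : 2 / 9 * c ^ 2 - 3 / 2 ≤ ellStar c := le_add_of_nonneg_right (by positivity)
    rw [h0] at hsurf
    linarith
  have hz : (27 - c ^ 2) / (27 * en) * en = (27 - c ^ 2) / 27 := by field_simp
  have h2 := (ellStar_lt_iff hc hc27 hen hz hsurf).1 hlt
  have hD : 0 < ((27 - c ^ 2) / (27 * en)) ^ 2 + 27 * (1 - (27 - c ^ 2) / (27 * en) * en) := by
    rw [hz]
    nlinarith [sq_nonneg ((27 - c ^ 2) / (27 * en)), pow_pos hc 2]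
  refine ⟨(27 - c ^ 2) / (27 * en), ⟨?_, hD, ?_⟩, ?_, ?_⟩
  · rw [hz]; linarith
  · rw [sub_pos, one_lt_div hD]; linarith
  · rw [hz]; ring
  · rw [mul_assoc, hz]; linarith

end SpinningBody

open SpinningBody in
theorem mainTheorem3 :
    (∀ en z : ℝ, InDomain en z → ∀ sgn : ℝ, (sgn = 1 ∨ sgn = -1) →
      -- equilibria on the Tulczyjew manifold, with `m = 1`, off the singularities
      ((N1 sgn en z).IsRegular en ∧
        (N1 sgn en z).OnTulczyjew en ∧
        (N1 sgn en z).massSq en = 1 ∧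
        (N1 sgn en z).IsEquilibrium en ∧
        0 < sgn * (N1 sgn en z).E 2) ∧
      -- the velocity is time-like
      ((N1 sgn en z).velSq en = -(z * en) ∧ (N1 sgn en z).velSq en < 0) ∧
      -- the orbit in space-time is an equatorial circle, and the direction of the spin
      ((N1 sgn en z).tRate en = 3 * en ∧
        (∃ x : FState, x.IsLift en (N1 sgn en z)) ∧
        ∀ x : FState, x.IsLift en (N1 sgn en z) →
          x.y 1 = 3 ∧ x.y 2 = Real.pi / 2 ∧ x.P 2 = 0 ∧
          x.P 3 ≠ 0 ∧ (x.P 3) ^ 2 = (N1 sgn en z).casimirF ∧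
          (N1 sgn en z).phiRate en (x.P 3) = x.P 3 / 9 ∧
          (∀ α, ∑ β, x.spin α β * x.momentum β = 0) ∧
          x.momentumSq = -1 ∧
          x.pauliLubanski 1 = 0 ∧ x.pauliLubanski 2 ≠ 0 ∧ x.pauliLubanski 3 ≠ 0) ∧
      -- the values of the integrals lie on the surface
      (0 < (N1 sgn en z).casimirC ∧
        z = (27 - (N1 sgn en z).casimirC) / (27 * en) ∧
        ((N1 sgn en z).casimirF, √(N1 sgn en z).casimirC, en) ∈ Sigma1)) ∧
    -- every point of the surface is attained
    (∀ ell c en : ℝ, (ell, c, en) ∈ Sigma1 →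
      ∃ z : ℝ, InDomain en z ∧ ∀ sgn : ℝ, (sgn = 1 ∨ sgn = -1) →
        (N1 sgn en z).casimirC = c ^ 2 ∧ (N1 sgn en z).casimirF = ell) := by
  refine ⟨fun en z hD sgn hs => ?_, fun ell c en hS => ?_⟩
  · have h := hD.isFamilyPoint hs
    have hen : en ≠ 0 := fun h0 => by simpa [h0] using hD.1
    refine ⟨⟨h.isRegular, h.onTulczyjew, h.massSq_eq, h.isEquilibrium, ?_⟩, ⟨h.velSq_eq, ?_⟩,
      ⟨h.tRate_eq, h.exists_lift, fun x hx => ?_⟩, ?_, ?_, ?_⟩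
    · have h3 := Real.sqrt_pos.2 hD.2.2
      have hsq : sgn * sgn = 1 := by rcases hs with rfl | rfl <;> norm_num
      simp only [N1, Matrix.cons_val, ← mul_assoc, hsq]
      linarith
    · rw [N1, h.velSq_eq]
      exact neg_neg_of_pos hD.1
    · obtain ⟨h1, h2, h3, h4, h5, h6⟩ := h.lift_spec hx
      exact ⟨h1, h2, h3, h4, h5.trans casimirF_slice.symm, h.phiRate_eq _, h6⟩
    · rw [N1, h.casimirC_eq]
      linarith [hD.pos.1]
    · rw [N1, h.casimirC_eq]
      field_simp
      ring
    · rw [N1, h.casimirC_eq, casimirF_slice, h.ell_eq]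
      exact hD.mem_Sigma1
  · obtain ⟨z, hz, h1, h2⟩ := exists_inDomain hS
    refine ⟨z, hz, fun sgn hs => ?_⟩
    have h := hz.isFamilyPoint hs
    rw [N1, h.casimirC_eq, casimirF_slice, h.ell_eq]
    exact ⟨h1, h2⟩
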